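/- Let $\mathcal M$ and $\mathcal O$ be finite sets (measurements and outcomes), and let $\mathcal C$ be a family of subsets of $\mathcal M$ (the contexts, i.e. the jointly measurable sets), each with at most two elements. A phenomenon for this binary contextuality scenario is a probability distribution $\mathcal P(ABXY)$ of random variables $X,Y\in\mathcal M$ (the chosen measurements) and $A,B\in\mathcal O$ (their respective outcomes) such that $\{x,y\}\in\mathcal C$ whenever $\mathcal P(x,y)>0$. It satisfies no-disturbance if $\mathcal P(A|XY)=\mathcal P(A|X)$ and $\mathcal P(B|XY)=\mathcal P(B|Y)$ for all values for which these conditionals are defined. It is KS-noncontextual if it has a factorisable hidden variable model: there are a discrete variable $\Lambda$ with a distribution $P(\Lambda)$ and conditional distributions $P(A|X\Lambda)$ and $P(B|Y\Lambda)$ (two separate families) such that $\mathcal P(AB|XY)=\sum_\Lambda P(\Lambda)P(A|X\Lambda)P(B|Y\Lambda)$ whenever $\mathcal P(XY)>0$. A KS-inequality of the scenario is a linear inequality $$\sum_{a,b,x,y}s(a,b,x,y)\,\mathcal P(ab|xy)\le\beta ,$$ with real $\beta$ and real coefficients $s$ that vanish unless $\{x,y\}\in\mathcal C$, that holds for every KS-noncontextual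 phenomenon for which all conditional probabilities with non-zero coefficient are defined. A phenomenon violates it if all these conditional probabilities are defined for it and the left-hand side exceeds $\beta$. A causal model for $\mathcal P$ consists of a finite, possibly empty, family of discrete latent variables $\Lambda$, a directed acyclic graph $\mathcal G$ whose nodes are $A,B,X,Y$ and the latent variables (with no restriction on the arrows), and a joint distribution $P(ABXY\Lambda)$ with $\mathcal P(ABXY)=\sum_\Lambda P(ABXY\Lambda)$ that is compatible with $\mathcal G$, i.e. the joint probability factorises as the product over all nodes $V$ of $P(V|Pa(V))$, where $Pa(V)$ is the set of parents of $V$ in $\mathcal G$. It is faithful if, for all pairwise disjoint sets $C,D,E$ of observable variables, whenever $C$ and $D$ are conditionally independent given $E$ in $\mathcal P$, they are d-separated given $E$ in $\mathcal G$. It requires fine-tuning if it is not faithful. Corollary. If a phenomenon $\mathcal P$ satisfies no-disturbance and violates some KS-inequality, then every causal model for $\mathcal P$ requires fine-tuning. -/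

import Mathlib

open scoped ENNReal

universe u

noncomputable section

namespace KSFineTuning

/-! Discrete joint distributions of a family of random variables `(ω v)`, `v : V`. -/

/-- The probability `P(ω_S)` that the variables in `S` take the values prescribed by `ω`. -/
def marg {V : Type*} {Val : V → Type*} (p : PMF (∀ v, Val v)) (S : Set V) (ω : ∀ v, Val v) :
    ℝ≥0∞ :=
  p.map (fun ω' (v : S) => ω' v) (fun v : S => ω v)

/-- The conditional probability `P(ω_S | ω_T)`; it is meaningful when `marg p T ω ≠ 0`
(and equals `0 / 0 = 0` otherwise). -/
def condProb {V : Type*} {Val : V → Type*} (p : PMF (∀ v, Val v)) (S T : Set V) (ω : ∀ v, Val v) :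
    ℝ≥0∞ :=
  marg p (S ∪ T) ω / marg p T ω

/-- Conditional independence of the sets of variables `C` and `D` given `E`:
`P(c, d, e) P(e) = P(c, e) P(d, e)` for all values. -/
def CondIndep {V : Type*} {Val : V → Type*} (p : PMF (∀ v, Val v)) (C D E : Set V) : Prop :=
  ∀ ω, marg p (C ∪ D ∪ E) ω * marg p E ω = marg p (C ∪ E) ω * marg p (D ∪ E) ω

/-- Directed acyclic graphs; `edge u v` is the arrow `u → v`. -/
structure DAG (V : Type*) where
  edge : V → V → Prop
  acyclic : ∀ v, ¬ Relation.TransGen edge v v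

namespace DAG

variable {V : Type*} (G : DAG V)

/-- The parents (direct causes) of `v`. -/
def parents (v : V) : Set V := {w | G.edge w v}

/-- Compatibility of a joint distribution with the graph (causal Markov condition, in the form
`P(x₁, …, xₙ) = ∏ⱼ P(xⱼ | pa(xⱼ))`). If a parent configuration of `ω` has probability zero, then
both sides are zero. -/
def Compatible [Fintype V] {Val : V → Type*} (p : PMF (∀ v, Val v)) : Prop :=
  ∀ ω, p ω = ∏ v, condProb p {v} (G.parents v) ω

/-- A path: distinct nodes, consecutive ones joined by an arrow in either direction. -/
def IsPath (l : List V) : Prop :=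
  l.Nodup ∧ l.IsChain (fun u v => G.edge u v ∨ G.edge v u)

/-- `v` is the middle node of a chain or a fork `u - v - w`. -/
def IsChainOrFork (u v w : V) : Prop :=
  (G.edge u v ∧ G.edge v w) ∨ (G.edge w v ∧ G.edge v u) ∨ (G.edge v u ∧ G.edge v w)

/-- `v` is the middle node of an inverted fork `u → v ← w`. -/
def IsCollider (u v w : V) : Prop := G.edge u v ∧ G.edge w v

/-- The path `l` is blocked by the set of nodes `Z`. -/
def Blocked (Z : Set V) (l : List V) : Prop :=
  ∃ u v w, [u, v, w] <:+: l ∧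
    ((G.IsChainOrFork u v w ∧ v ∈ Z) ∨
      (G.IsCollider u v w ∧ v ∉ Z ∧ ∀ z ∈ Z, ¬ Relation.TransGen G.edge v z))

/-- `C` and `D` are d-separated by `Z`: every path from `C` to `D` is blocked by `Z`. -/
def DSep (C D Z : Set V) : Prop :=
  ∀ l : List V, G.IsPath l → (∃ c ∈ C, l.head? = some c) → (∃ d ∈ D, l.getLast? = some d) →
    G.Blocked Z l

end DAG

/-- The observable variables of a binary scenario: the settings `X`, `Y` (the two measurements
that are chosen) and their respective outcomes `A`, `B`. -/
inductive Obs
  | A | B | X | Y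
  deriving DecidableEq

instance : Fintype Obs where
  elems := {.A, .B, .X, .Y}
  complete o := by cases o <;> simp

/-- Outcomes take values in `O`, settings in the set `M` of measurements. -/
abbrev ObsVal (M O : Type u) : Obs → Type u
  | .A => O
  | .B => O
  | .X => M
  | .Y => M

/-- A binary measurement scenario: a compatibility structure on `M` whose contexts contain at most
two measurements. -/
structure BinaryScenario (M : Type u) where
  contexts : Set (Set M)
  binary : ∀ c ∈ contexts, c.encard ≤ 2

/-- A phenomenon: a distribution of the observable variables such that, in every run, the two
chosen measurements are jointly measurable. -/
structure Phenomenon {M : Type u} (S : BinaryScenario M) (O : Type u) where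
  dist : PMF (∀ o, ObsVal M O o)
  compatible : ∀ ω ∈ dist.support, ({ω .X, ω .Y} : Set M) ∈ S.contexts

/-- The assignment `A = a, B = b, X = x, Y = y`. -/
def obs {M O : Type u} (a b : O) (x y : M) : ∀ o, ObsVal M O o
  | .A => a
  | .B => b
  | .X => x
  | .Y => y

namespace Phenomenon

variable {M O : Type u} {S : BinaryScenario M} (P : Phenomenon S O)

/-- No-disturbance: `P(A|XY) = P(A|X)` and `P(B|XY) = P(B|Y)` wherever defined. -/
def NoDisturbance : Prop :=
  ∀ ω, marg P.dist {.X, .Y} ω ≠ 0 →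
    condProb P.dist {.A} {.X, .Y} ω = condProb P.dist {.A} {.X} ω ∧
    condProb P.dist {.B} {.X, .Y} ω = condProb P.dist {.B} {.Y} ω

/-- KS-noncontextuality, i.e. existence of a factorisable hidden variable model:
`P(AB|XY) = ∑_Λ P(Λ) P(A|XΛ) P(B|YΛ)` wherever the left-hand side is defined. -/
def KSNoncontextual : Prop :=
  ∃ (Λ : Type u) (μ : PMF Λ) (f g : M → Λ → PMF O),
    ∀ ω, marg P.dist {.X, .Y} ω ≠ 0 →
      condProb P.dist {.A, .B} {.X, .Y} ω =
        ∑' l, μ l * f (ω .X) l (ω .A) * g (ω .Y) l (ω .B)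

/-- All conditional probabilities `P(ab|xy)` which occur in the linear expression
`∑ s(a,b,x,y) P(ab|xy)` are defined for the phenomenon. -/
def Tests (s : O → O → M → M → ℝ) : Prop :=
  ∀ a b x y, s a b x y ≠ 0 → marg P.dist {.X, .Y} (obs a b x y) ≠ 0

/-- The value of the linear expression `∑ s(a,b,x,y) P(ab|xy)`. -/
def value [Fintype M] [Fintype O] (s : O → O → M → M → ℝ) : ℝ :=
  ∑ x, ∑ y, ∑ a, ∑ b, s a b x y * (condProb P.dist {.A, .B} {.X, .Y} (obs a b x y)).toReal

end Phenomenon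

/-- The linear inequality `∑ s(a,b,x,y) P(ab|xy) ≤ β`, over the contexts `{x, y}` of the scenario,
is a KS-inequality: it bounds the set of KS-noncontextual phenomena of the scenario. -/
def IsKSInequality {M O : Type u} [Fintype M] [Fintype O] (S : BinaryScenario M)
    (s : O → O → M → M → ℝ) (β : ℝ) : Prop :=
  (∀ a b x y, s a b x y ≠ 0 → ({x, y} : Set M) ∈ S.contexts) ∧
    ∀ P : Phenomenon S O, P.KSNoncontextual → P.Tests s → P.value s ≤ β

/-- The phenomenon violates the inequality `∑ s(a,b,x,y) P(ab|xy) ≤ β`. -/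
def Phenomenon.Violates {M O : Type u} [Fintype M] [Fintype O] {S : BinaryScenario M}
    (P : Phenomenon S O) (s : O → O → M → M → ℝ) (β : ℝ) : Prop :=
  P.Tests s ∧ β < P.value s

/-- The value spaces of the nodes of a causal model with latent variables indexed by `L`. -/
abbrev NodeVal (M O : Type u) {L : Type u} (LVal : L → Type u) : Obs ⊕ L → Type u
  | .inl o => ObsVal M O o
  | .inr l => LVal l

/-- A causal model for a phenomenon: a finite, possibly empty, family of latent variables, a DAG
on the observable and latent variables, and a joint distribution compatible with the DAG whose
marginal on the observable variables is the phenomenon. -/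
structure CausalModel {M O : Type u} {S : BinaryScenario M} (P : Phenomenon S O) where
  Latent : Type u
  [fintypeLatent : Fintype Latent]
  LatentVal : Latent → Type u
  graph : DAG (Obs ⊕ Latent)
  joint : PMF (∀ v, NodeVal M O LatentVal v)
  compatible : graph.Compatible joint
  reproduces : joint.map (fun ω o => ω (.inl o)) = P.dist

/-- Faithfulness (no fine-tuning): every conditional independence between (disjoint sets of)
observable variables in the phenomenon corresponds to a d-separation in the causal graph. -/
def CausalModel.Faithful {M O : Type u} {S : BinaryScenario M} {P : Phenomenon S O}
    (Γ : CausalModel P) : Prop :=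
  ∀ C D E : Set Obs, Disjoint C D → Disjoint C E → Disjoint D E → CondIndep P.dist C D E →
    Γ.graph.DSep (Sum.inl '' C) (Sum.inl '' D) (Sum.inl '' E)

/-- A causal model requires fine-tuning iff it is not faithful. -/
def CausalModel.FineTuned {M O : Type u} {S : BinaryScenario M} {P : Phenomenon S O}
    (Γ : CausalModel P) : Prop :=
  ¬ Γ.Faithful

end KSFineTuning

end

/-! A non-disturbing phenomenon with a faithful causal model has a factorisable hidden variable
model (`CausalModel.Faithful.ksNoncontextual`), so it cannot violate a KS-inequality. Faithfulness
is used only for the two independences that express no-disturbance: X d-separates A from Y, and Y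
d-separates B from X.

The hidden variable is the set L of common ancestors of A and B that are ancestors of neither X nor
Y. In the moral graph of the ancestors of A, X, Y, deleting X leaves a set P of nodes around A that
misses Y (`DSep.exists_moral_component`); symmetrically there is Q around B that misses X. A
directed path from a node of P ∩ Q to X or Y would stay inside P ∩ Q up to its end, which is
impossible. Hence P ∩ Q contains no ancestor of X or Y, and P ∩ Q = L. This makes L ancestral and
disjoint from the ancestors of X and Y, so L is independent of XY. Separation in the moral graphs
gives A ⟂ Y | XL, B ⟂ X | YL and A ⟂ B | XYL (`Compatible.exists_screening_set`).

Separation becomes independence because the marginal on an ancestral set is the product of its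
kernels (`Compatible.marg_eq_prod_kernel`). This product splits into two factors that share only the
conditioning variables (`Compatible.condIndep`). The four independences turn the law of total
probability over L into the factorised formula (`condProb_eq_tsum_condDist`). -/

noncomputable section

namespace KSFineTuning

/-! ### Active walks, and d-separation as separation in the moral graph -/

namespace DAG

variable {V : Type*} (G : DAG V)

/-- The reflexive ancestors of the nodes in `S`. -/
def ancestors (S : Set V) : Set V := {v | ∃ s ∈ S, Relation.ReflTransGen G.edge v s}

/-- A set of nodes that contains the parents of its members. -/
def IsAncestral (S : Set V) : Prop := ∀ v ∈ S, G.parents v ⊆ S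

/-- A node together with its parents. -/
def family (v : V) : Set V := insert v (G.parents v)

/-- A walk that is not blocked by `Z`; nodes may be repeated. -/
def IsActiveWalk (Z : Set V) (l : List V) : Prop :=
  l.IsChain (fun u v => G.edge u v ∨ G.edge v u) ∧ ¬ G.Blocked Z l

variable {G} {Z : Set V}

lemma subset_ancestors (S : Set V) : S ⊆ G.ancestors S := fun s hs => ⟨s, hs, .refl⟩

lemma isAncestral_ancestors (S : Set V) : G.IsAncestral (G.ancestors S) := by
  rintro v ⟨s, hs, h⟩ w hw
  exact ⟨s, hs, .head hw h⟩

lemma mem_family_self (v : V) : v ∈ G.family v := Set.mem_insert _ _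

lemma mem_family_of_edge {u v : V} (h : G.edge u v) : u ∈ G.family v := Set.mem_insert_of_mem _ h

lemma IsAncestral.family_subset {S : Set V} (h : G.IsAncestral S) {v : V} (hv : v ∈ S) :
    G.family v ⊆ S := Set.insert_subset hv (h v hv)

lemma edge_asymm {u v : V} (h : G.edge u v) : ¬ G.edge v u := fun h' =>
  G.acyclic u ((Relation.TransGen.single h).tail h')

lemma IsChainOrFork.of_left {u v w : V} (h : G.edge v u) (hw : G.edge v w ∨ G.edge w v) :
    G.IsChainOrFork u v w := by
  rcases hw with hw | hw
  · exact .inr (.inr ⟨h, hw⟩)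
  · exact .inr (.inl ⟨hw, h⟩)

lemma IsChainOrFork.not_isCollider {u v w : V} (h : G.IsChainOrFork u v w) :
    ¬ G.IsCollider u v w := by
  rintro ⟨h1, h2⟩
  rcases h with h | h | h
  · exact edge_asymm h2 h.2
  · exact edge_asymm h1 h.2
  · exact edge_asymm h1 h.1

lemma Blocked.of_infix {l l' : List V} (hl : l <:+: l') (h : G.Blocked Z l) : G.Blocked Z l' := by
  obtain ⟨u, v, w, h1, h2⟩ := h
  exact ⟨u, v, w, h1.trans hl, h2⟩

lemma IsActiveWalk.of_infix {l l' : List V} (h : G.IsActiveWalk Z l') (hl : l <:+: l') :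
    G.IsActiveWalk Z l :=
  ⟨h.1.infix hl, fun hb => h.2 (hb.of_infix hl)⟩

/-- Extending an active walk at its first node. -/
lemma IsActiveWalk.cons {v w : V} {l : List V} (h : G.IsActiveWalk Z (v :: l))
    (hadj : G.edge w v ∨ G.edge v w)
    (hfork : ∀ n, l.head? = some n → G.IsChainOrFork w v n → v ∉ Z)
    (hcol : ∀ n, l.head? = some n → G.IsCollider w v n → v ∈ G.ancestors Z) : G.IsActiveWalk Z (w :: v :: l) := by
  refine ⟨List.isChain_cons_cons.2 ⟨hadj, h.1⟩, ?_⟩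
  rintro ⟨a, b, c, hinf, hb⟩
  rcases List.infix_cons_iff.1 hinf with hpre | hinf
  · rw [List.cons_prefix_cons, List.cons_prefix_cons] at hpre
    obtain ⟨rfl, rfl, hc⟩ := hpre
    have hhead : l.head? = some c := by
      obtain ⟨t, rfl⟩ := hc
      rfl
    rcases hb with ⟨hb, hz⟩ | ⟨hb, hz, hd⟩
    · exact hfork c hhead hb hz
    · obtain ⟨s, hs, hvs⟩ := hcol c hhead hb
      rcases Relation.reflTransGen_iff_eq_or_transGen.1 hvs with rfl | hvs
      · exact hz hs
      · exact hd s hs hvs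
  · exact h.2 ⟨a, b, c, hinf, hb⟩

/-- With an arrow from `v` to the new node, `v` cannot be a collider, so only `v ∉ Z` is needed. -/
lemma IsActiveWalk.cons_child {v w : V} {l : List V} (h : G.IsActiveWalk Z (v :: l))
    (hadj : G.edge v w) (hv : v ∉ Z) : G.IsActiveWalk Z (w :: v :: l) :=
  h.cons (.inr hadj) (fun _ _ _ => hv) fun _ _ h' => (edge_asymm h'.1 hadj).elim

lemma isActiveWalk_of_isChain_edge {l : List V} (h : l.IsChain G.edge) (hZ : ∀ v ∈ l, v ∉ Z) :
    G.IsActiveWalk Z l := by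
  refine ⟨h.imp fun _ _ => Or.inl, ?_⟩
  rintro ⟨u, v, w, hinf, hb⟩
  have h' := h.infix hinf
  rw [List.isChain_cons_cons, List.isChain_cons_cons] at h'
  rcases hb with ⟨-, hz⟩ | ⟨hb, -⟩
  · exact hZ v (hinf.subset (by simp)) hz
  · exact edge_asymm h'.2.1 hb.2

/-- An active walk can be continued along a directed path whose nodes are not ancestors of the
conditioning set. -/
lemma IsActiveWalk.extend_directed {t c a : V} {l : List V} (h : G.IsActiveWalk Z (t :: l))
    (hl : (t :: l).getLast? = some a) (ht : t ∉ G.ancestors Z)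
    (hc : Relation.ReflTransGen G.edge t c) :
    ∃ l', G.IsActiveWalk Z (c :: l') ∧ (c :: l').getLast? = some a := by
  induction hc with
  | refl => exact ⟨l, h, hl⟩
  | @tail b c hb hbc ih =>
    obtain ⟨l', h1, h2⟩ := ih
    refine ⟨b :: l', h1.cons_child hbc fun hbZ => ht ⟨b, hbZ, hb⟩, ?_⟩
    rwa [List.getLast?_cons_cons]

/-- No descendant of `t` lies in `Z`, so a directed path from `w` through `t` to `a` avoids `Z`;
having no colliders, it is active. -/
lemma exists_isActiveWalk_of_directed {t w a : V} (ht : t ∉ G.ancestors Z) (hw : w ∉ Z)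
    (hwt : G.edge w t) (hta : Relation.ReflTransGen G.edge t a) :
    ∃ l, G.IsActiveWalk Z (w :: l) ∧ (w :: l).getLast? = some a := by
  have key : ∃ l, (t :: l).IsChain G.edge ∧ (∀ v ∈ t :: l, v ∉ Z) ∧
      (t :: l).getLast? = some a := by
    induction hta using Relation.ReflTransGen.head_induction_on generalizing w with
    | refl => exact ⟨[], by simp, by simpa using fun h => ht (subset_ancestors _ h), rfl⟩
    | @head b c hbc _ ih =>
      obtain ⟨l, h1, h2, h3⟩ := ih (w := b) (fun ⟨s, hs, h⟩ => ht ⟨s, hs, .head hbc h⟩)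
        (fun h => ht (subset_ancestors _ h)) hbc
      refine ⟨c :: l, List.isChain_cons_cons.2 ⟨hbc, h1⟩, ?_, by rwa [List.getLast?_cons_cons]⟩
      intro v hv
      rcases List.mem_cons.1 hv with rfl | hv
      · exact fun h => ht (subset_ancestors _ h)
      · exact h2 v hv
  obtain ⟨l, h1, h2, h3⟩ := key
  refine ⟨t :: l, isActiveWalk_of_isChain_edge (List.isChain_cons_cons.2 ⟨hwt, h1⟩) ?_,
    by rwa [List.getLast?_cons_cons]⟩
  intro v hv
  rcases List.mem_cons.1 hv with rfl | hv
  · exact hw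
  · exact h2 v hv

/-- An active walk that leaves `v` along an arrow stays among the descendants of `v` if `v` is not
an ancestor of the conditioning set. -/
lemma IsActiveWalk.transGen_of_mem {v r : V} {l : List V} (h : G.IsActiveWalk Z (v :: r :: l))
    (hvr : G.edge v r) (hv : v ∉ G.ancestors Z) : ∀ x ∈ r :: l, Relation.TransGen G.edge v x := by
  induction l generalizing v r with
  | nil => simpa using Relation.TransGen.single hvr
  | cons w l ih =>
    have hr : r ∉ G.ancestors Z := fun ⟨s, hs, h⟩ => hv ⟨s, hs, .head hvr h⟩
    -- The opposite arrow would make `r` a collider that is not an ancestor of `Z`, blocking the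
    -- walk.
    have hrw : G.edge r w := by
      have h1 := h.1
      rw [List.isChain_cons_cons, List.isChain_cons_cons] at h1
      refine h1.2.1.resolve_right fun hwr => h.2 ⟨v, r, w, ⟨[], l, by simp⟩, .inr ⟨⟨hvr, hwr⟩,
        fun h => hr (subset_ancestors _ h), fun z hz h => hr ⟨z, hz, h.to_reflTransGen⟩⟩⟩
    intro x hx
    rcases List.mem_cons.1 hx with rfl | hx
    · exact .single hvr
    · exact .head hvr (ih (h.of_infix (List.infix_cons List.infix_rfl)) hrw hr x hx)

/-- Active walks that overlap in an arrow can be glued. -/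
lemma IsActiveWalk.glue {k t : List V} {u v : V} (h : G.IsActiveWalk Z (k ++ [u, v]))
    (h' : G.IsActiveWalk Z (u :: v :: t)) : G.IsActiveWalk Z (k ++ u :: v :: t) := by
  induction k with
  | nil => exact h'
  | cons x k ih =>
    have ih := ih (h.of_infix (List.infix_cons List.infix_rfl))
    have hpre : x :: k ++ [u, v] <+: x :: k ++ u :: v :: t := ⟨t, by simp⟩
    constructor
    · have h1 := ih.1
      have h2 := h.1
      cases k with
      | nil => exact List.isChain_cons_cons.2 ⟨(List.isChain_cons_cons.1 h2).1, h1⟩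
      | cons y k => exact List.isChain_cons_cons.2 ⟨(List.isChain_cons_cons.1 h2).1, h1⟩
    -- As the overlap has two nodes, a blocking triple at the front lies wholly in the first walk;
    -- any other is covered by induction.
    · rintro ⟨a, b, c, hinf, hb⟩
      rcases List.infix_cons_iff.1 hinf with hinf | hinf
      · exact h.2 ⟨a, b, c,
          (List.prefix_of_prefix_length_le hinf hpre (by simp)).isInfix, hb⟩
      · exact ih.2 ⟨a, b, c, hinf, hb⟩

/-- Cutting a closed detour out of an active walk leaves an active walk. -/
lemma IsActiveWalk.cut {v : V} {l₁ l₂ l₃ : List V}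
    (h : G.IsActiveWalk Z (l₁ ++ v :: (l₂ ++ v :: l₃))) : G.IsActiveWalk Z (l₁ ++ v :: l₃) := by
  have hleft : G.IsActiveWalk Z (l₁ ++ [v]) := h.of_infix ⟨[], l₂ ++ v :: l₃, by simp⟩
  have hright : G.IsActiveWalk Z (v :: l₃) := h.of_infix ⟨l₁ ++ v :: l₂, [], by simp⟩
  rcases List.eq_nil_or_concat l₁ with rfl | ⟨k, u, rfl⟩
  · simpa using hright
  rcases l₃ with _ | ⟨w, m⟩
  · exact hleft
  obtain ⟨r, l', hr⟩ : ∃ r l', l₂ ++ v :: w :: m = r :: l' := by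
    cases l₂ <;> simp
  have hvmem : v ∈ r :: l' := by simp [← hr]
  rw [hr] at h
  simp only [List.concat_eq_append, List.append_assoc, List.singleton_append] at h hleft ⊢
  have hloop : G.IsActiveWalk Z (u :: v :: r :: l') := h.of_infix ⟨k, [], by simp⟩
  have hadj := hloop.1
  rw [List.isChain_cons_cons, List.isChain_cons_cons] at hadj
  have huv := hadj.1
  have hvr := hadj.2.1
  have hloop' : G.IsActiveWalk Z (v :: r :: l') :=
    hloop.of_infix (List.infix_cons List.infix_rfl)
  have huvr : [u, v, r] <:+: u :: v :: r :: l' := ⟨[], l', by simp⟩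
  have hwadj := (List.isChain_cons_cons.1 hright.1).1
  have htriple : G.IsActiveWalk Z (u :: v :: w :: m) := by
    -- Only the triple `u, v, w` is new. If it is a collider, `v` must be an ancestor of `Z`.
    -- Otherwise the detour either leaves `v` by an arrow and closes a directed cycle, or enters `v`
    -- and makes `u, v, r` a blocked collider of the original walk.
    by_cases hcol : G.edge u v ∧ G.edge w v
    · refine hright.cons huv (fun n hn hf => ?_) fun _ _ _ => ?_
      · simp only [List.head?_cons, Option.some.injEq] at hn
        subst hn
        exact (hf.not_isCollider hcol).elim
      · by_contra hv
        refine hvr.elim (fun hvr => ?_) fun hrv => ?_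
        · exact G.acyclic v (hloop'.transGen_of_mem hvr hv v hvmem)
        · exact hloop.2 ⟨u, v, r, huvr, .inr ⟨⟨hcol.1, hrv⟩,
            fun h => hv (subset_ancestors _ h), fun z hz h => hv ⟨z, hz, h.to_reflTransGen⟩⟩⟩
    -- A non-collider needs `v ∉ Z`. If `v → u`, the first visit to `v` is already a non-collider;
    -- if `v → w`, the second visit is.
    · by_cases hvu : G.edge v u
      · refine hright.cons_child hvu fun hz =>
          hloop.2 ⟨u, v, r, huvr, .inl ⟨.of_left hvu hvr, hz⟩⟩
      · have huv' := huv.resolve_right hvu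
        have hvw : G.edge v w := hwadj.resolve_right fun h => hcol ⟨huv', h⟩
        refine hright.cons huv (fun _ _ _ hz => ?_) fun n hn hc => ?_
        swap
        · simp only [List.head?_cons, Option.some.injEq] at hn
          subst hn
          exact (hcol hc).elim
        -- `q` is the node just before the second visit to `v`.
        obtain ⟨j, q, hq⟩ : ∃ j q, v :: l₂ = j ++ [q] :=
          ⟨_, _, (List.dropLast_append_getLast (List.cons_ne_nil v l₂)).symm⟩
        have hqvw : [q, v, w] <:+: u :: v :: r :: l' := by
          refine ⟨u :: j, m, ?_⟩
          have : u :: j ++ [q, v, w] ++ m = u :: (j ++ [q]) ++ v :: w :: m := by simp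
          rw [this, ← hq, ← hr]
          simp
        have hqv := List.isChain_pair.1 ((hloop.1.infix hqvw).infix ⟨[], [w], rfl⟩)
        refine hloop.2 ⟨q, v, w, hqvw, .inl ⟨?_, hz⟩⟩
        rcases hqv with hqv | hqv
        · exact .inl ⟨hqv, hvw⟩
        · exact .inr (.inr ⟨hqv, hvw⟩)
  exact hleft.glue htriple

/-- Nodes that are joined by an active walk are joined by an active path. -/
lemma IsActiveWalk.exists_isPath {a b : V} {l : List V} (h : G.IsActiveWalk Z l)
    (hb : l.head? = some b) (ha : l.getLast? = some a) :
    ∃ l', G.IsPath l' ∧ l'.head? = some b ∧ l'.getLast? = some a ∧ ¬ G.Blocked Z l' := by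
  induction hn : l.length using Nat.strong_induction_on generalizing l with
  | _ n ih =>
    by_cases hd : l.Nodup
    · exact ⟨l, ⟨hd, h.1⟩, hb, ha, h.2⟩
    · obtain ⟨v, hv⟩ := List.exists_duplicate_iff_not_nodup.2 hd
      obtain ⟨l₁, l₂, l₃, rfl⟩ : ∃ l₁ l₂ l₃, l = l₁ ++ v :: (l₂ ++ v :: l₃) := by
        obtain ⟨r₁, r₂, rfl, h1, h2⟩ := List.cons_sublist_iff.1 (List.duplicate_iff_sublist.1 hv)
        obtain ⟨s₁, s₂, rfl⟩ := List.append_of_mem h1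
        obtain ⟨t₁, t₂, rfl⟩ := List.append_of_mem (List.singleton_sublist.1 h2)
        exact ⟨s₁, s₂ ++ t₁, t₂, by simp⟩
      refine ih _ ?_ h.cut ?_ ?_ rfl
      · simp at hn ⊢
        omega
      · cases l₁ <;> simpa using hb
      · simpa [List.getLast?_append, List.getLast?_cons] using ha

/-- If `a` and `b` are d-separated by `Z`, then they lie in different components of the moral graph
of the ancestors of `a`, `b` and `Z` after removal of `Z`: `P` is the component of `a`. -/
lemma DSep.exists_moral_component {a b : V} (h : G.DSep {b} {a} Z) (ha : a ∉ Z) :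
    ∃ P ⊆ G.ancestors (insert a (insert b Z)) \ Z, a ∈ P ∧ b ∉ P ∧
      ∀ v ∈ G.ancestors (insert a (insert b Z)),
        G.family v ⊆ P ∪ Z ∨ Disjoint (G.family v) P := by
  set S := G.ancestors (insert a (insert b Z)) with hS
  have hS_anc : G.IsAncestral S := isAncestral_ancestors _
  have not_reach : ∀ l, G.IsActiveWalk Z (b :: l) → (b :: l).getLast? ≠ some a := by
    intro l hl hla
    obtain ⟨l', h1, h2, h3, h4⟩ := hl.exists_isPath rfl hla
    exact h4 (h l' h1 ⟨b, rfl, h2⟩ ⟨a, rfl, h3⟩)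
  -- The nodes with an active walk to `a`. The component sought is the part of `R` in `S` outside
  -- `Z`.
  let R : Set V := {v | ∃ l, G.IsActiveWalk Z (v :: l) ∧ (v :: l).getLast? = some a}
  -- Handles moral edges between co-parents. If `t` is an ancestor of `Z`, a collider at `t` is
  -- open. Otherwise a directed path from `t` leads to `a`, giving a new walk from `w`, or to `b`,
  -- giving an active walk from `b` to `a` against d-separation.
  have collider : ∀ {t w : V} {l : List V}, t ∈ S → G.IsActiveWalk Z (t :: l) →
      (t :: l).getLast? = some a → w ∉ Z → G.edge w t →
      (∀ n, l.head? = some n → G.IsChainOrFork w t n → t ∉ Z) → w ∈ R := by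
    intro t w l htS hl hla hw hwt hfork
    by_cases ht : t ∈ G.ancestors Z
    · exact ⟨t :: l, hl.cons (.inl hwt) hfork fun _ _ _ => ht, by rwa [List.getLast?_cons_cons]⟩
    · obtain ⟨s, hs, hts⟩ := htS
      rcases hs with rfl | rfl | hs
      · exact exists_isActiveWalk_of_directed ht hw hwt hts
      · obtain ⟨l', h1, h2⟩ := hl.extend_directed hla ht hts
        exact (not_reach l' h1 h2).elim
      · exact (ht ⟨s, hs, hts⟩).elim
  refine ⟨(S ∩ R) \ Z, fun v hv => ⟨hv.1.1, hv.2⟩,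
    ⟨⟨subset_ancestors _ (Set.mem_insert _ _), [], ⟨by simp, ?_⟩, rfl⟩, ha⟩,
    fun ⟨⟨_, l, h1, h2⟩, _⟩ => not_reach l h1 h2, ?_⟩
  · rintro ⟨u, v, w, hinf, -⟩
    simpa using hinf.length_le
  · intro v hv
    rw [or_iff_not_imp_right, Set.not_disjoint_iff]
    rintro ⟨u, hu, ⟨huS, l, hl, hla⟩, huZ⟩ w hw
    by_cases hwZ : w ∈ Z
    · exact .inr hwZ
    refine .inl ⟨⟨hS_anc.family_subset hv hw, ?_⟩, hwZ⟩
    rcases hu with rfl | hu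
    · rcases hw with rfl | hw
      · exact ⟨l, hl, hla⟩
      · exact collider huS hl hla hwZ hw fun _ _ _ => huZ
    · have hl' := hl.cons_child hu huZ
      have hla' : (v :: u :: l).getLast? = some a := by rwa [List.getLast?_cons_cons]
      rcases hw with rfl | hw
      · exact ⟨_, hl', hla'⟩
      · refine collider hv hl' hla' hwZ hw fun n hn hf => ?_
        simp only [List.head?_cons, Option.some.injEq] at hn
        subst hn
        exact (hf.not_isCollider ⟨hw, hu⟩).elim

end DAG

/-! ### Partial sums over coordinates, and marginals -/

section Sums

variable {V : Type*} {Val : V → Type*}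

/-- The sum of `f` over all values of the variables in `T`, the others being fixed by `ω`. -/
def sumOver (T : Set V) (f : (∀ v, Val v) → ℝ≥0∞) (ω : ∀ v, Val v) : ℝ≥0∞ :=
  ∑' ω', {ω' : ∀ v, Val v | ∀ v ∉ T, ω' v = ω v}.indicator f ω'

open Classical in
/-- The assignment `η` of the variables in `T`, continued by `ω`. -/
def override (T : Set V) (η : ∀ v : T, Val v) (ω : ∀ v, Val v) (v : V) : Val v :=
  if h : v ∈ T then η ⟨v, h⟩ else ω v

lemma override_of_mem {T : Set V} (η : ∀ v : T, Val v) (ω : ∀ v, Val v) {v : V} (h : v ∈ T) :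
    override T η ω v = η ⟨v, h⟩ := dif_pos h

lemma override_of_notMem {T : Set V} (η : ∀ v : T, Val v) (ω : ∀ v, Val v) {v : V} (h : v ∉ T) :
    override T η ω v = ω v := dif_neg h

lemma sumOver_eq_tsum_override (T : Set V) (f : (∀ v, Val v) → ℝ≥0∞) (ω : ∀ v, Val v) :
    sumOver T f ω = ∑' η : (∀ v : T, Val v), f (override T η ω) := by
  have hinj : Function.Injective fun η : (∀ v : T, Val v) => override T η ω := by
    intro η η' h
    ext v
    have := congrFun h v
    simpa [override_of_mem _ _ v.2] using this
  have hsupp : Function.support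
      ({ω' : ∀ v, Val v | ∀ v ∉ T, ω' v = ω v}.indicator f) ⊆
        Set.range fun η : (∀ v : T, Val v) => override T η ω := by
    intro ω' hω'
    have hmem : ∀ v ∉ T, ω' v = ω v := Set.mem_of_indicator_ne_zero hω'
    refine ⟨fun v => ω' v, funext fun v => ?_⟩
    by_cases hv : v ∈ T
    · exact override_of_mem _ _ hv
    · exact (override_of_notMem _ _ hv).trans (hmem v hv).symm
  rw [sumOver, ← hinj.tsum_eq hsupp]
  refine tsum_congr fun η => Set.indicator_of_mem ?_ f
  exact fun v hv => override_of_notMem _ _ hv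

lemma sumOver_congr {T : Set V} {f g : (∀ v, Val v) → ℝ≥0∞} {ω : ∀ v, Val v}
    (h : ∀ ω', (∀ v ∉ T, ω' v = ω v) → f ω' = g ω') : sumOver T f ω = sumOver T g ω :=
  tsum_congr fun ω' => by
    by_cases hω' : ω' ∈ {ω' : ∀ v, Val v | ∀ v ∉ T, ω' v = ω v}
    · rw [Set.indicator_of_mem hω', Set.indicator_of_mem hω', h ω' hω']
    · rw [Set.indicator_of_notMem hω', Set.indicator_of_notMem hω']

lemma sumOver_univ (f : (∀ v, Val v) → ℝ≥0∞) (ω : ∀ v, Val v) :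
    sumOver Set.univ f ω = ∑' ω', f ω' :=
  tsum_congr fun _ => Set.indicator_of_mem (fun _ hv => (hv trivial).elim) f

lemma sumOver_empty (f : (∀ v, Val v) → ℝ≥0∞) (ω : ∀ v, Val v) : sumOver ∅ f ω = f ω := by
  have : {ω' : ∀ v, Val v | ∀ v ∉ (∅ : Set V), ω' v = ω v} = {ω} := by
    ext ω'
    simp [funext_iff]
  rw [sumOver, this, tsum_eq_single ω fun ω' (h : ω' ∉ ({ω} : Set _)) => Set.indicator_of_notMem h f]
  exact Set.indicator_of_mem rfl f

lemma sumOver_mul_left {T s : Set V} {f g : (∀ v, Val v) → ℝ≥0∞} (hg : DependsOn g s)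
    (hs : Disjoint s T) (ω : ∀ v, Val v) :
    sumOver T (fun ω' => g ω' * f ω') ω = g ω * sumOver T f ω := by
  rw [sumOver_eq_tsum_override, sumOver_eq_tsum_override, ← ENNReal.tsum_mul_left]
  refine tsum_congr fun η => ?_
  congr 1
  exact hg fun v hv => override_of_notMem _ _ (Set.disjoint_left.1 hs hv)

lemma sumOver_sumOver {T₁ T₂ : Set V} (h : Disjoint T₁ T₂) (f : (∀ v, Val v) → ℝ≥0∞)
    (ω : ∀ v, Val v) : sumOver T₁ (sumOver T₂ f) ω = sumOver (T₁ ∪ T₂) f ω := by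
  classical
  rw [sumOver_eq_tsum_override]
  simp only [sumOver]
  rw [ENNReal.tsum_comm]
  refine tsum_congr fun ω' => ?_
  -- For fixed `ω'`, only the restriction of `ω'` to `T₁` can agree with it off `T₂`, since `T₁` and
  -- `T₂` are disjoint.
  rw [tsum_eq_single fun v : T₁ => ω' v]
  · have hiff : (∀ v ∉ T₂, ω' v = override T₁ (fun v : T₁ => ω' v) ω v) ↔
        ∀ v ∉ T₁ ∪ T₂, ω' v = ω v := by
      constructor
      · intro h' v hv
        rw [Set.mem_union, not_or] at hv
        rw [h' v hv.2, override_of_notMem _ _ hv.1]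
      · intro h' v hv
        by_cases hv1 : v ∈ T₁
        · rw [override_of_mem _ _ hv1]
        · rw [override_of_notMem _ _ hv1, h' v (by simp [hv, hv1])]
    simp only [Set.indicator_apply, Set.mem_ofPred_eq, hiff]
  · intro η hη
    refine Set.indicator_of_notMem (fun h' => hη ?_) f
    ext v
    have := h' v (Set.disjoint_left.1 h v.2)
    rw [this, override_of_mem _ _ v.2]

lemma _root_.DependsOn.sumOver {T s : Set V} {f : (∀ v, Val v) → ℝ≥0∞} (hf : DependsOn f s) :
    DependsOn (sumOver T f) (s \ T) := by
  intro ω ω' h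
  rw [sumOver_eq_tsum_override, sumOver_eq_tsum_override]
  refine tsum_congr fun η => hf fun v hv => ?_
  by_cases hvT : v ∈ T
  · rw [override_of_mem _ _ hvT, override_of_mem _ _ hvT]
  · rw [override_of_notMem _ _ hvT, override_of_notMem _ _ hvT]
    exact h v ⟨hv, hvT⟩

lemma dependsOn_prod {ι : Type*} {T : Finset ι} {f : ι → (∀ v, Val v) → ℝ≥0∞} {s : Set V}
    (h : ∀ i ∈ T, DependsOn (f i) s) : DependsOn (fun ω => ∏ i ∈ T, f i ω) s :=
  fun _ _ hω => Finset.prod_congr rfl fun i hi => h i hi hω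

lemma marg_eq_toOuterMeasure (p : PMF (∀ v, Val v)) (S : Set V) (ω : ∀ v, Val v) :
    marg p S ω = p.toOuterMeasure {ω' | ∀ v ∈ S, ω' v = ω v} := by
  classical
  rw [marg, PMF.map_apply, PMF.toOuterMeasure_apply]
  refine tsum_congr fun ω' => ?_
  rw [Set.indicator_apply]
  congr 1
  simp [funext_iff, eq_comm]

lemma marg_eq_sumOver (p : PMF (∀ v, Val v)) (S : Set V) (ω : ∀ v, Val v) :
    marg p S ω = sumOver Sᶜ p ω := by
  rw [marg_eq_toOuterMeasure, PMF.toOuterMeasure_apply, sumOver]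
  simp

lemma dependsOn_marg (p : PMF (∀ v, Val v)) (S : Set V) : DependsOn (marg p S) S := by
  intro ω ω' h
  have : (fun v : S => ω v) = fun v : S => ω' v := funext fun v => h v v.2
  simp only [marg, this]

lemma marg_anti (p : PMF (∀ v, Val v)) {S T : Set V} (h : S ⊆ T) (ω : ∀ v, Val v) :
    marg p T ω ≤ marg p S ω := by
  rw [marg_eq_toOuterMeasure, marg_eq_toOuterMeasure]
  exact p.toOuterMeasure.mono fun ω' h' v hv => h' v (h hv)

lemma marg_ne_top (p : PMF (∀ v, Val v)) (S : Set V) (ω : ∀ v, Val v) : marg p S ω ≠ ∞ :=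
  PMF.apply_ne_top _ _

lemma marg_empty (p : PMF (∀ v, Val v)) (ω : ∀ v, Val v) : marg p ∅ ω = 1 := by
  rw [marg_eq_sumOver, Set.compl_empty, sumOver_univ, p.tsum_coe]

lemma sumOver_marg (p : PMF (∀ v, Val v)) {S T : Set V} (h : T ⊆ S) (ω : ∀ v, Val v) :
    sumOver T (marg p S) ω = marg p (S \ T) ω := by
  have hm : marg p S = sumOver Sᶜ p := funext (marg_eq_sumOver p S)
  rw [hm, sumOver_sumOver ((disjoint_compl_right (a := S)).mono_left h), marg_eq_sumOver]
  congr 1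
  ext v
  simp only [Set.mem_union, Set.mem_compl_iff, Set.mem_sdiff]
  tauto

end Sums

/-! ### The Markov factorisation on ancestral sets -/

namespace DAG

variable {V : Type*} {G : DAG V} {Val : V → Type*} {p : PMF (∀ v, Val v)}

lemma notMem_parents (v : V) : v ∉ G.parents v := fun h => edge_asymm h h

variable (G p) in
open Classical in
/-- The conditional distribution of `v` given its parents, with a default value where
this is undefined. -/
def kernel (v : V) (ω : ∀ v, Val v) : ℝ≥0∞ :=
  if marg p (G.parents v) ω = 0 then marg p {v} ω else condProb p {v} (G.parents v) ω

lemma dependsOn_kernel (v : V) : DependsOn (G.kernel p v) (G.family v) := by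
  intro ω ω' h
  have h1 := dependsOn_marg p (G.parents v) fun w hw => h w (Set.mem_insert_of_mem _ hw)
  have h2 := dependsOn_marg p {v} fun w hw => h w (Set.mem_singleton_iff.1 hw ▸ mem_family_self _)
  have h3 := dependsOn_marg p ({v} ∪ G.parents v) fun w hw => h w hw
  simp only [kernel, condProb, h1, h2, h3]

/-- The default value in `kernel` is there for this: normalisation holds at null parent
configurations too. -/
lemma sumOver_kernel (v : V) (ω : ∀ v, Val v) : sumOver {v} (G.kernel p v) ω = 1 := by
  have hpa : ∀ ω', (∀ w ∉ ({v} : Set V), ω' w = ω w) →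
      marg p (G.parents v) ω' = marg p (G.parents v) ω := fun ω' h =>
    dependsOn_marg p _ fun w hw => h w fun hwv => notMem_parents v (hwv ▸ hw)
  by_cases h0 : marg p (G.parents v) ω = 0
  · rw [sumOver_congr (g := marg p {v}), sumOver_marg p subset_rfl, Set.sdiff_self, marg_empty]
    intro ω' h
    rw [kernel, if_pos ((hpa ω' h).trans h0)]
  · rw [sumOver_congr
      (g := fun ω' => (fun _ => (marg p (G.parents v) ω)⁻¹) ω' * marg p ({v} ∪ G.parents v) ω'),
      sumOver_mul_left (s := ∅) (fun _ _ _ => rfl) (Set.empty_disjoint _),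
      sumOver_marg p Set.subset_union_left, Set.union_sdiff_left,
      Set.sdiff_singleton_eq_self (notMem_parents v), ENNReal.inv_mul_cancel h0 (marg_ne_top _ _ _)]
    intro ω' h
    rw [kernel, if_neg (by rwa [hpa ω' h]), condProb, hpa ω' h, ENNReal.div_eq_inv_mul]

lemma condProb_le_kernel (v : V) (ω : ∀ v, Val v) :
    condProb p {v} (G.parents v) ω ≤ G.kernel p v ω := by
  rw [kernel]
  split_ifs with h
  · have : marg p ({v} ∪ G.parents v) ω = 0 :=
      le_antisymm ((marg_anti p Set.subset_union_right ω).trans h.le) zero_le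
    rw [condProb, this, ENNReal.zero_div]
    exact zero_le
  · exact le_rfl

/-- Acyclicity gives a node of `T` without children in `T`. No other kernel in the product depends
on it, so it is summed out first, contributing 1. -/
lemma sumOver_prod_kernel [Finite V] (T : Finset V) (ω : ∀ v, Val v) :
    sumOver T (fun ω' => ∏ v ∈ T, G.kernel p v ω') ω = 1 := by
  classical
  induction hn : T.card generalizing T ω with
  | zero =>
    obtain rfl := Finset.card_eq_zero.1 hn
    rw [Finset.coe_empty, sumOver_empty, Finset.prod_empty]
  | succ n ih =>
    obtain ⟨v, hvT, hv⟩ : ∃ v ∈ T, ∀ w ∈ T, ¬ G.edge v w := by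
      let r : V → V → Prop := fun a b => Relation.TransGen G.edge b a
      have : IsTrans V r := ⟨fun a b c h1 h2 => h2.trans h1⟩
      have : Std.Irrefl r := ⟨G.acyclic⟩
      obtain ⟨v, hv, hmin⟩ := (Finite.wellFounded_of_trans_of_irrefl r).has_min (T : Set V)
        (Finset.coe_nonempty.2 (Finset.card_pos.1 (by omega)))
      exact ⟨v, hv, fun w hw h => hmin w hw (.single h)⟩
    have hT : (T : Set V) = ↑(T.erase v) ∪ {v} := by
      rw [Finset.coe_erase, Set.sdiff_union_self, Set.union_singleton,
        Set.insert_eq_of_mem (Finset.mem_coe.2 hvT)]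
    have hdisj : Disjoint (↑(T.erase v) : Set V) {v} := by simp
    rw [hT, ← sumOver_sumOver hdisj, ← ih (T.erase v) ω (by rw [Finset.card_erase_of_mem hvT]; omega)]
    refine sumOver_congr fun ω' _ => ?_
    simp only [← Finset.prod_erase_mul T _ hvT]
    rw [sumOver_mul_left (s := {v}ᶜ), sumOver_kernel, mul_one]
    · refine dependsOn_prod fun w hw => (dependsOn_kernel w).mono ?_
      rintro u (rfl | hu) rfl
      · exact (Finset.notMem_erase _ _ hw).elim
      · exact hv w (Finset.mem_of_mem_erase hw) hu
    · exact disjoint_compl_left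

variable [Fintype V]

/-- Replacing conditional probabilities by kernels can only increase the product, but both sides
have total mass 1, so no value can increase. -/
lemma Compatible.apply_eq_prod_kernel (h : G.Compatible p) (ω : ∀ v, Val v) :
    p ω = ∏ v, G.kernel p v ω := by
  have hle : ∀ ω, p ω ≤ ∏ v, G.kernel p v ω := fun ω => by
    rw [h ω]
    exact Finset.prod_le_prod' fun v _ => condProb_le_kernel v ω
  refine le_antisymm (hle ω) (not_lt.1 fun hlt => ?_)
  have hsum := sumOver_prod_kernel (G := G) (p := p) Finset.univ ω
  rw [Finset.coe_univ, sumOver_univ] at hsum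
  have := ENNReal.tsum_lt_tsum (by simp) hle hlt
  rw [p.tsum_coe, hsum] at this
  exact this.false

/-- Kernels of an ancestral set do not involve the variables outside it, and the kernels outside sum
to 1. -/
lemma Compatible.marg_eq_prod_kernel (h : G.Compatible p) {S : Finset V} (hS : G.IsAncestral S)
    (ω : ∀ v, Val v) : marg p S ω = ∏ v ∈ S, G.kernel p v ω := by
  classical
  have hp : (p : (∀ v, Val v) → ℝ≥0∞) =
      fun ω => (∏ v ∈ S, G.kernel p v ω) * ∏ v ∈ Sᶜ, G.kernel p v ω := by
    funext ω
    rw [h.apply_eq_prod_kernel ω, Finset.prod_mul_prod_compl]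
  have hdep : DependsOn (fun ω => ∏ v ∈ S, G.kernel p v ω) (S : Set V) :=
    dependsOn_prod fun v hv => (dependsOn_kernel v).mono (hS.family_subset hv)
  calc marg p S ω
      = sumOver (S : Set V)ᶜ
          (fun ω => (∏ v ∈ S, G.kernel p v ω) * ∏ v ∈ Sᶜ, G.kernel p v ω) ω := by
        rw [marg_eq_sumOver, ← hp]
    _ = ∏ v ∈ S, G.kernel p v ω := by
        rw [sumOver_mul_left hdep disjoint_compl_right, ← Finset.coe_compl, sumOver_prod_kernel,
          mul_one]

/-- If every family of an ancestral set of nodes `P₁ ∪ P₂ ∪ E` lies in `P₁ ∪ E` or in `P₂ ∪ E`,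
then `E` screens off `P₁` from `P₂`. -/
theorem Compatible.condIndep (h : G.Compatible p) {P₁ P₂ E C D : Set V}
    (hS : G.IsAncestral (P₁ ∪ P₂ ∪ E)) (h12 : Disjoint P₁ P₂) (h1E : Disjoint P₁ E)
    (h2E : Disjoint P₂ E)
    (hfam : ∀ v ∈ P₁ ∪ P₂ ∪ E, G.family v ⊆ P₁ ∪ E ∨ G.family v ⊆ P₂ ∪ E)
    (hC : C ⊆ P₁ ∪ E) (hD : D ⊆ P₂ ∪ E) : CondIndep p C D E := by
  classical
  obtain ⟨S, hSeq⟩ : ∃ S : Finset V, (S : Set V) = P₁ ∪ P₂ ∪ E := ⟨_, Set.coe_toFinset _⟩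
  let F : (∀ v, Val v) → ℝ≥0∞ := fun ω =>
    ∏ v ∈ S with G.family v ⊆ P₁ ∪ E, G.kernel p v ω
  let H : (∀ v, Val v) → ℝ≥0∞ := fun ω =>
    ∏ v ∈ S with ¬ G.family v ⊆ P₁ ∪ E, G.kernel p v ω
  have hF : DependsOn F (P₁ ∪ E) :=
    dependsOn_prod fun v hv => (dependsOn_kernel v).mono (Finset.mem_filter.1 hv).2
  have hH : DependsOn H (P₂ ∪ E) := by
    refine dependsOn_prod fun v hv => (dependsOn_kernel v).mono ?_
    have hv := Finset.mem_filter.1 hv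
    exact (hfam v (hSeq ▸ Finset.mem_coe.2 hv.1)).resolve_left hv.2
  have hmarg : marg p (P₁ ∪ P₂ ∪ E) = fun ω => F ω * H ω := by
    funext ω
    rw [← hSeq, h.marg_eq_prod_kernel (hSeq ▸ hS) ω]
    exact (Finset.prod_filter_mul_prod_filter_not S _ _).symm
  -- `F` is free of `P₂` and `H` of `P₁`, so every such marginal factorises. The claim compares four
  -- instances, with `C` and `D` kept or replaced by `∅`.
  have key : ∀ C ⊆ P₁ ∪ E, ∀ D ⊆ P₂ ∪ E, ∀ ω,
      marg p (C ∪ D ∪ E) ω = sumOver (P₁ \ C) F ω * sumOver (P₂ \ D) H ω := by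
    intro C hC D hD ω
    have hset : C ∪ D ∪ E = (P₁ ∪ P₂ ∪ E) \ ((P₁ \ C) ∪ (P₂ \ D)) := by
      ext v
      have h1 := @hC v
      have h2 := @hD v
      have h3 : v ∈ P₁ → v ∉ P₂ := fun h => Set.disjoint_left.1 h12 h
      have h4 : v ∈ P₁ → v ∉ E := fun h => Set.disjoint_left.1 h1E h
      have h5 : v ∈ P₂ → v ∉ E := fun h => Set.disjoint_left.1 h2E h
      simp only [Set.mem_union, Set.mem_sdiff] at *
      tauto
    rw [hset, ← sumOver_marg p (by
        refine Set.union_subset ?_ ?_ <;> intro v hv <;> simp [hv.1]),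
      ← sumOver_sumOver (h12.mono Set.sdiff_subset Set.sdiff_subset), hmarg]
    have hdisj1 : Disjoint (P₁ ∪ E) (P₂ \ D) :=
      (Set.disjoint_union_left.2 ⟨h12, h2E.symm⟩).mono_right Set.sdiff_subset
    have hdisj2 : Disjoint ((P₂ ∪ E) \ (P₂ \ D)) (P₁ \ C) :=
      (Set.disjoint_union_left.2 ⟨h12.symm, h1E.symm⟩).mono Set.sdiff_subset Set.sdiff_subset
    rw [sumOver_congr fun ω' _ => sumOver_mul_left hF hdisj1 ω', mul_comm,
      ← sumOver_mul_left hH.sumOver hdisj2]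
    exact sumOver_congr fun ω' _ => mul_comm _ _
  intro ω
  have h1 := key C hC D hD ω
  have h2 := key ∅ (Set.empty_subset _) ∅ (Set.empty_subset _) ω
  have h3 := key C hC ∅ (Set.empty_subset _) ω
  have h4 := key ∅ (Set.empty_subset _) D hD ω
  simp only [Set.empty_union, Set.union_empty] at h1 h2 h3 h4
  rw [h1, h2, h3, h4]
  ring

end DAG

/-! ### The common causes that screen off the outcomes -/

namespace DAG

open Relation

variable {V : Type*} {G : DAG V} {Val : V → Type*} {p : PMF (∀ v, Val v)}

lemma mem_ancestors_singleton {v s : V} : v ∈ G.ancestors {s} ↔ ReflTransGen G.edge v s := by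
  simp [ancestors]

lemma mem_ancestors_insert {v s : V} {S : Set V} :
    v ∈ G.ancestors (insert s S) ↔ ReflTransGen G.edge v s ∨ v ∈ G.ancestors S := by
  simp [ancestors]

/-- Two sets of nodes are screened off by `F` if `F` separates them in the moral graph of an ancestral
set `U`; here `P` is a union of components of this graph. -/
lemma Compatible.condIndep_of_family [Fintype V] (hc : G.Compatible p) {U P F C D : Set V}
    (hU : G.IsAncestral U) (hP : P ⊆ U) (hF : F ⊆ U)
    (hfam : ∀ v ∈ U, G.family v ⊆ P ∪ F ∨ G.family v ∩ P ⊆ F)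
    (hC : C ⊆ P ∪ F) (hD : D ⊆ U) (hDP : D ∩ P ⊆ F) : CondIndep p C D F := by
  have hunion : P \ F ∪ U \ (P ∪ F) ∪ F = U := by
    rw [← Set.sdiff_sdiff, Set.union_assoc]
    ext v
    have h1 := @hP v
    have h2 := @hF v
    simp only [Set.mem_union, Set.mem_sdiff]
    tauto
  have hrest : ∀ W ⊆ U, W ∩ P ⊆ F → W ⊆ U \ (P ∪ F) ∪ F := by
    intro W hW hWP v hv
    by_cases hvF : v ∈ F
    · exact .inr hvF
    · exact .inl ⟨hW hv, fun h => hvF (h.elim (fun h => hWP ⟨hv, h⟩) id)⟩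
  refine hc.condIndep (P₁ := P \ F) (P₂ := U \ (P ∪ F)) (hunion.symm ▸ hU) ?_
    Set.disjoint_sdiff_left (Set.disjoint_left.2 fun v hv h => hv.2 (.inr h)) ?_
    (by rwa [Set.sdiff_union_self]) (hrest D hD hDP)
  · exact Set.disjoint_left.2 fun v hv h => h.2 (.inl hv.1)
  · rw [hunion, Set.sdiff_union_self]
    exact fun v hv => (hfam v hv).imp_right fun h => hrest _ (hU.family_subset hv) h

variable (G) in
/-- `P` is a union of components, containing `a` but not `y`, of the moral graph of the ancestors
of `a`, `x`, `y` after removal of `x`. -/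
structure IsMoralSeparator (P : Set V) (a x y : V) : Prop where
  subset : P ⊆ G.ancestors {a, y, x}
  left_mem : a ∈ P
  middle_notMem : x ∉ P
  right_notMem : y ∉ P
  family : ∀ v ∈ G.ancestors {a, y, x}, G.family v ⊆ P ∪ {x} ∨ Disjoint (G.family v) P

lemma DSep.exists_isMoralSeparator {a x y : V} (h : G.DSep {y} {a} {x}) (hax : a ≠ x) :
    ∃ P, G.IsMoralSeparator P a x y := by
  obtain ⟨P, hP, ha, hy, hfam⟩ := h.exists_moral_component (Set.notMem_singleton_iff.2 hax)
  exact ⟨P, fun v hv => (hP hv).1, ha, fun hx => (hP hx).2 rfl, hy, hfam⟩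

namespace IsMoralSeparator

variable {P Q L : Set V} {a b x y : V}

lemma family_subset (h : G.IsMoralSeparator P a x y) {u v : V} (hv : v ∈ G.ancestors {a, y, x})
    (hu : u ∈ G.family v) (huP : u ∈ P) : G.family v ⊆ P ∪ {x} :=
  (h.family v hv).resolve_right fun hd => Set.disjoint_left.1 hd hu huP

/-- Going back from `a`, each parent shares a family with a node of `P`, so it can leave `P` only by
being `x`. -/
lemma mem_of_reflTransGen (h : G.IsMoralSeparator P a x y) {v : V}
    (hva : ReflTransGen G.edge v a) (hx : ¬ ReflTransGen G.edge v x) : v ∈ P := by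
  induction hva using ReflTransGen.head_induction_on with
  | refl => exact h.left_mem
  | @head v w hvw hwa ih =>
    have hw := ih fun hwx => hx (.head hvw hwx)
    have hmem := h.family_subset (h.subset hw) (mem_family_self w) hw (mem_family_of_edge hvw)
    refine hmem.resolve_right fun hvx => hx ?_
    rw [Set.mem_singleton_iff.1 hvx]

/-- A child of a node of `P ∩ Q` on the way to `y` lies in `P ∪ {x}` and in `Q ∪ {y}`, hence again
in `P ∩ Q`. The path would thus end with `y ∈ P`. -/
lemma notMem_of_reflTransGen (hP : G.IsMoralSeparator P a x y) (hQ : G.IsMoralSeparator Q b y x)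
    (hxy : x ≠ y) {v : V} (hvy : ReflTransGen G.edge v y) (hvP : v ∈ P) : v ∉ Q := by
  induction hvy using ReflTransGen.head_induction_on with
  | refl => exact (hP.right_notMem hvP).elim
  | @head v w hvw hwy ih =>
    intro hvQ
    have hwP := hP.family_subset
      (mem_ancestors_insert.2 (.inr (mem_ancestors_insert.2 (.inl hwy))))
      (mem_family_of_edge hvw) hvP (mem_family_self w)
    have hwQ := hQ.family_subset
      (mem_ancestors_insert.2 (.inr (mem_ancestors_insert.2 (.inr (mem_ancestors_singleton.2 hwy)))))
      (mem_family_of_edge hvw) hvQ (mem_family_self w)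
    rcases hwP with hwP | rfl
    · rcases hwQ with hwQ | rfl
      · exact ih hwP hwQ
      · exact hP.right_notMem hwP
    · rcases hwQ with hwQ | hwQ
      · exact hQ.right_notMem hwQ
      · exact hxy hwQ

/-- Conditioning on further nodes on the side of `a` does not reconnect `a` to `y` in the moral
graph. -/
lemma condIndep [Fintype V] (hc : G.Compatible p) (h : G.IsMoralSeparator P a x y)
    (hL : L ⊆ P) : CondIndep p {a} {y} ({x} ∪ L) := by
  have hx : x ∈ G.ancestors {a, y, x} := subset_ancestors _ (by simp)
  have hy : y ∈ G.ancestors {a, y, x} := subset_ancestors _ (by simp)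
  refine hc.condIndep_of_family (isAncestral_ancestors _) h.subset
    (Set.union_subset (Set.singleton_subset_iff.2 hx) (hL.trans h.subset)) (fun v hv => ?_)
    (Set.singleton_subset_iff.2 (.inl h.left_mem)) (Set.singleton_subset_iff.2 hy) ?_
  · refine (h.family v hv).imp (fun hf u hu => ?_) fun hd u hu =>
      (Set.disjoint_left.1 hd hu.1 hu.2).elim
    exact (hf hu).imp_right .inl
  · rintro v ⟨rfl, hv⟩
    exact (h.right_notMem hv).elim

end IsMoralSeparator

/-- If `x` d-separates `a` from `y` and `y` d-separates `b` from `x`, then the common ancestors of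
`a` and `b` which are not ancestors of `x` or `y` are independent of `x` and `y`, and they
screen off `a` from `b` and `y`, and `b` from `a` and `x`. -/
theorem Compatible.exists_screening_set [Fintype V] (hc : G.Compatible p) {a b x y : V}
    (hax : a ≠ x) (hby : b ≠ y) (hxy : x ≠ y)
    (ha : G.DSep {y} {a} {x}) (hb : G.DSep {x} {b} {y}) :
    ∃ L : Set V, x ∉ L ∧ y ∉ L ∧ CondIndep p L {x, y} ∅ ∧ CondIndep p {a} {y} ({x} ∪ L) ∧
      CondIndep p {b} {x} ({y} ∪ L) ∧ CondIndep p {a} {b} ({x, y} ∪ L) := by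
  obtain ⟨P, hP⟩ := ha.exists_isMoralSeparator hax
  obtain ⟨Q, hQ⟩ := hb.exists_isMoralSeparator hby
  have hPQ : ∀ v, v ∈ P → v ∈ Q → v ∉ G.ancestors {x, y} := by
    intro v hvP hvQ hv
    rw [mem_ancestors_insert, mem_ancestors_singleton] at hv
    rcases hv with hv | hv
    · exact hQ.notMem_of_reflTransGen hP hxy.symm hv hvQ hvP
    · exact hP.notMem_of_reflTransGen hQ hxy hv hvP hvQ
  set N := G.ancestors {x, y} with hN
  have hNanc : G.IsAncestral N := isAncestral_ancestors _
  have hNx : x ∈ N := subset_ancestors _ (by simp)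
  have hNy : y ∈ N := subset_ancestors _ (by simp)
  have memN : ∀ v, v ∈ N ↔ ReflTransGen G.edge v x ∨ ReflTransGen G.edge v y := fun v => by
    rw [hN, mem_ancestors_insert, mem_ancestors_singleton]
  have memS₁ : ∀ v, v ∈ G.ancestors {a, y, x} ↔ ReflTransGen G.edge v a ∨ v ∈ N := fun v => by
    rw [mem_ancestors_insert, mem_ancestors_insert, mem_ancestors_singleton, memN]
    tauto
  have memS₂ : ∀ v, v ∈ G.ancestors {b, x, y} ↔ ReflTransGen G.edge v b ∨ v ∈ N := fun _ =>
    mem_ancestors_insert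
  let L : Set V := {v | ReflTransGen G.edge v a ∧ ReflTransGen G.edge v b ∧ v ∉ N}
  have hLP : L ⊆ P := fun v hv =>
    hP.mem_of_reflTransGen hv.1 fun h => hv.2.2 ((memN v).2 (.inl h))
  have hLQ : L ⊆ Q := fun v hv =>
    hQ.mem_of_reflTransGen hv.2.1 fun h => hv.2.2 ((memN v).2 (.inr h))
  have hPQL : ∀ v, v ∈ P → v ∈ Q → v ∈ L := fun v hvP hvQ =>
    have hv := hPQ v hvP hvQ
    ⟨((memS₁ v).1 (hP.subset hvP)).resolve_right hv, ((memS₂ v).1 (hQ.subset hvQ)).resolve_right hv,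
      hv⟩
  -- The point is that a parent of a node of `L` is not an ancestor of `x` or `y`: it lies in `P ∪
  -- {x}` and `Q ∪ {y}`, hence in `P ∩ Q`.
  have hLanc : G.IsAncestral L := by
    intro v hv w hw
    refine ⟨.head hw hv.1, .head hw hv.2.1, ?_⟩
    have hwP := hP.family_subset (hP.subset (hLP hv)) (mem_family_self v) (hLP hv)
      (mem_family_of_edge hw)
    have hwQ := hQ.family_subset (hQ.subset (hLQ hv)) (mem_family_self v) (hLQ hv)
      (mem_family_of_edge hw)
    rcases hwP with hwP | rfl
    · rcases hwQ with hwQ | rfl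
      · exact hPQ w hwP hwQ
      · exact (hP.right_notMem hwP).elim
    · rcases hwQ with hwQ | hwQ
      · exact (hQ.right_notMem hwQ).elim
      · exact (hxy hwQ).elim
  have hxL : x ∉ L := fun h => h.2.2 hNx
  have hyL : y ∉ L := fun h => h.2.2 hNy
  refine ⟨L, hxL, hyL, ?_, hP.condIndep hc hLP, hQ.condIndep hc hLQ, ?_⟩
  · refine hc.condIndep (P₁ := L) (P₂ := N) ?_ (Set.disjoint_left.2 fun v hv => hv.2.2)
      (Set.disjoint_empty _) (Set.disjoint_empty _) ?_ (by simp) ?_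
    · rintro v ((hv | hv) | hv) w hw
      · exact .inl (.inl (hLanc v hv hw))
      · exact .inl (.inr (hNanc v hv hw))
      · exact hv.elim
    · rintro v ((hv | hv) | hv)
      · exact .inl ((hLanc.family_subset hv).trans Set.subset_union_left)
      · exact .inr ((hNanc.family_subset hv).trans Set.subset_union_left)
      · exact hv.elim
    · rintro v (rfl | rfl)
      exacts [.inl hNx, .inl hNy]
  · set S₁ := G.ancestors {a, y, x} with hS₁
    set S₂ := G.ancestors {b, x, y} with hS₂
    have hS₁anc : G.IsAncestral S₁ := isAncestral_ancestors _
    have hS₂anc : G.IsAncestral S₂ := isAncestral_ancestors _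
    refine hc.condIndep_of_family (U := S₁ ∪ S₂) (P := P) ?_ (hP.subset.trans Set.subset_union_left)
      (Set.union_subset ?_ ?_) ?_ (Set.singleton_subset_iff.2 (.inl hP.left_mem))
      (Set.singleton_subset_iff.2 (.inr (hQ.subset hQ.left_mem))) ?_
    · rintro v (hv | hv) w hw
      exacts [.inl (hS₁anc v hv hw), .inr (hS₂anc v hv hw)]
    · rintro v (rfl | rfl)
      exacts [.inl ((memS₁ _).2 (.inr hNx)), .inl ((memS₁ _).2 (.inr hNy))]
    · exact (hLP.trans hP.subset).trans Set.subset_union_left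
    · intro v hv
      by_cases hv1 : v ∈ S₁
      · refine (hP.family v hv1).imp (fun hf u hu => ?_) fun hd u hu =>
          (Set.disjoint_left.1 hd hu.1 hu.2).elim
        exact (hf hu).imp_right fun h => .inl (.inl h)
      -- Outside `S₁`, `v` is an ancestor of `b` only, so its family lies in `Q ∪ {y}` and meets `P`
      -- only inside `L`.
      · refine .inr fun u ⟨hu, huP⟩ => ?_
        have hv2 : v ∈ S₂ := hv.resolve_left hv1
        have hvN : v ∉ N := fun h => hv1 ((memS₁ v).2 (.inr h))
        have hvQ : v ∈ Q := hQ.mem_of_reflTransGen (((memS₂ v).1 hv2).resolve_right hvN)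
          fun h => hvN ((memN v).2 (.inr h))
        rcases hQ.family_subset hv2 (mem_family_self v) hvQ hu with huQ | rfl
        · exact .inr (hPQL u huP huQ)
        · exact (hP.right_notMem huP).elim
    · rintro v ⟨rfl, hv⟩
      exact .inr (hPQL _ hv hQ.left_mem)

end DAG

/-! ### From screening off to a factorisable model -/

section HiddenVariable

variable {V : Type*} {Val : V → Type*} {p : PMF (∀ v, Val v)}

/-- The assignments that agree with `ω` on `S`. -/
def cylinder (S : Set V) (ω : ∀ v, Val v) : Set (∀ v, Val v) := {ω' | ∀ v ∈ S, ω' v = ω v}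

lemma toOuterMeasure_cylinder (S : Set V) (ω : ∀ v, Val v) :
    p.toOuterMeasure (cylinder S ω) = marg p S ω :=
  (marg_eq_toOuterMeasure p S ω).symm

lemma cylinder_union (S T : Set V) (ω : ∀ v, Val v) :
    cylinder (S ∪ T) ω = cylinder S ω ∩ cylinder T ω := by
  ext ω'
  simp [cylinder, or_imp, forall_and]

lemma cylinder_inter_cylinder_of_ne {S L : Set V} {ω l : ∀ v, Val v} {v : V} (hS : v ∈ S)
    (hL : v ∈ L) (hne : ω v ≠ l v) : cylinder S ω ∩ cylinder L l = ∅ :=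
  Set.eq_empty_of_forall_notMem fun _ h => hne ((h.1 v hS).symm.trans (h.2 v hL))

lemma cylinder_inter_cylinder {S L : Set V} {ω l : ∀ v, Val v}
    (h : ∀ v ∈ S, v ∈ L → ω v = l v) :
    cylinder S ω ∩ cylinder L l = cylinder (S ∪ L) (override L (fun v => l v) ω) := by
  rw [cylinder_union]
  have hL : cylinder L (override L (fun v => l v) ω) = cylinder L l := by
    ext ω'
    exact forall₂_congr fun v hv => by rw [override_of_mem _ _ hv]
  have hS : cylinder S (override L (fun v => l v) ω) = cylinder S ω := by
    ext ω'
    refine forall₂_congr fun v hv => ?_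
    by_cases hvL : v ∈ L
    · rw [override_of_mem _ _ hvL, h v hv hvL]
    · rw [override_of_notMem _ _ hvL]
  rw [hL, hS]

lemma toOuterMeasure_ne_top (T : Set (∀ v, Val v)) : p.toOuterMeasure T ≠ ∞ :=
  ne_top_of_le_ne_top ENNReal.one_ne_top <|
    (p.toOuterMeasure_apply T).trans_le <| (ENNReal.tsum_le_tsum fun ω => by
      exact Set.indicator_le_self _ _ ω).trans p.tsum_coe.le

lemma marg_ne_zero {l : ∀ v, Val v} (hl : p l ≠ 0) (L : Set V) : marg p L l ≠ 0 := by
  rw [← toOuterMeasure_cylinder, Ne, PMF.toOuterMeasure_apply_eq_zero_iff, Set.not_disjoint_iff]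
  exact ⟨l, (p.mem_support_iff l).2 hl, fun _ _ => rfl⟩

/-- Conditional independence given `E ∪ L`, with the variables in `L` fixed by a second
assignment. -/
lemma CondIndep.toOuterMeasure_mul {C D E L : Set V} (h : CondIndep p C D (E ∪ L))
    (hEL : Disjoint E L) (ω l : ∀ v, Val v) :
    p.toOuterMeasure (cylinder (C ∪ D ∪ E) ω ∩ cylinder L l) *
        p.toOuterMeasure (cylinder E ω ∩ cylinder L l) =
      p.toOuterMeasure (cylinder (C ∪ E) ω ∩ cylinder L l) *
        p.toOuterMeasure (cylinder (D ∪ E) ω ∩ cylinder L l) := by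
  -- Outcomes may themselves belong to `L`. Where `ω` and `l` disagree on them, both sides vanish.
  by_cases hag : ∀ v ∈ C ∪ D, v ∈ L → ω v = l v
  · have hE : ∀ v ∈ E, v ∈ L → ω v = l v := fun v hv hvL =>
      (Set.disjoint_left.1 hEL hv hvL).elim
    rw [cylinder_inter_cylinder fun v hv => hv.elim (hag v) (hE v), cylinder_inter_cylinder hE,
      cylinder_inter_cylinder fun v hv => hv.elim (fun h => hag v (.inl h)) (hE v),
      cylinder_inter_cylinder fun v hv => hv.elim (fun h => hag v (.inr h)) (hE v)]
    simp only [toOuterMeasure_cylinder, Set.union_assoc] at h ⊢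
    simpa only [Set.union_assoc] using h (override L (fun v => l v) ω)
  · push Not at hag
    obtain ⟨v, hv, hvL, hne⟩ := hag
    rw [cylinder_inter_cylinder_of_ne (.inl hv) hvL hne]
    rcases hv with hv | hv
    · rw [cylinder_inter_cylinder_of_ne (S := C ∪ E) (.inl hv) hvL hne]
      simp
    · rw [cylinder_inter_cylinder_of_ne (S := D ∪ E) (.inl hv) hvL hne]
      simp

/-- The law of total probability, with respect to the variables in `L`. -/
lemma tsum_mul_div_marg (S L : Set V) (ω : ∀ v, Val v) :
    ∑' l, p l * (p.toOuterMeasure (cylinder S ω ∩ cylinder L l) / marg p L l) = marg p S ω := by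
  classical
  have hL : ∀ l l', l ∈ cylinder L l' → marg p L l = marg p L l' := fun l l' h =>
    dependsOn_marg p L h
  calc ∑' l, p l * (p.toOuterMeasure (cylinder S ω ∩ cylinder L l) / marg p L l)
      = ∑' l, ∑' ω', (cylinder S ω).indicator p ω' / marg p L ω' * (cylinder L ω').indicator p l := by
        refine tsum_congr fun l => ?_
        rw [PMF.toOuterMeasure_apply, ENNReal.div_eq_inv_mul, ← ENNReal.tsum_mul_left,
          ← ENNReal.tsum_mul_left]
        refine tsum_congr fun ω' => ?_
        have hmem : ω' ∈ cylinder L l ↔ l ∈ cylinder L ω' :=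
          forall₂_congr fun v _ => eq_comm
        by_cases h1 : l ∈ cylinder L ω'
        · by_cases h2 : ω' ∈ cylinder S ω
          · rw [Set.indicator_of_mem (Set.mem_inter h2 (hmem.2 h1)), Set.indicator_of_mem h2,
              Set.indicator_of_mem h1, hL _ _ h1, ENNReal.div_eq_inv_mul, mul_comm]
          · rw [Set.indicator_of_notMem (fun h => h2 h.1), Set.indicator_of_notMem h2]
            simp
        · rw [Set.indicator_of_notMem (fun h => h1 (hmem.1 h.2)), Set.indicator_of_notMem h1]
          simp
    _ = ∑' ω', (cylinder S ω).indicator p ω' := by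
        -- The weights `p l` of the `l` agreeing with `ω'` on `L` add up to `marg p L ω'` and cancel
        -- the denominator.
        rw [ENNReal.tsum_comm]
        refine tsum_congr fun ω' => ?_
        rw [ENNReal.tsum_mul_left, ← PMF.toOuterMeasure_apply, toOuterMeasure_cylinder]
        by_cases h0 : marg p L ω' = 0
        · have : (cylinder S ω).indicator p ω' = 0 := by
            refine Set.indicator_apply_eq_zero.2 fun _ => ?_
            by_contra hne
            exact marg_ne_zero hne L h0
          simp [this]
        · exact ENNReal.div_mul_cancel h0 (marg_ne_top _ _ _)
    _ = marg p S ω := by rw [← PMF.toOuterMeasure_apply, toOuterMeasure_cylinder]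

variable (p) in
open Classical in
/-- The distribution of the variable `v` given the event `T`, with a default value if `T` has
probability zero. -/
def condDist (T : Set (∀ v, Val v)) (v : V) : PMF (Val v) :=
  if h : ∃ ω ∈ T, ω ∈ p.support then (p.filter T h).map fun ω => ω v else p.map fun ω => ω v

lemma condDist_apply {T : Set (∀ v, Val v)} (hT : p.toOuterMeasure T ≠ 0) (v : V) (ω : ∀ v, Val v) :
    condDist p T v (ω v) =
      p.toOuterMeasure (cylinder {v} ω ∩ T) / p.toOuterMeasure T := by
  classical
  have h : ∃ ω ∈ T, ω ∈ p.support := by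
    rw [Ne, PMF.toOuterMeasure_apply_eq_zero_iff, Set.not_disjoint_iff] at hT
    obtain ⟨ω, h1, h2⟩ := hT
    exact ⟨ω, h2, h1⟩
  rw [condDist, dif_pos h, PMF.map_apply, div_eq_mul_inv, PMF.toOuterMeasure_apply,
    PMF.toOuterMeasure_apply, ← ENNReal.tsum_mul_right]
  refine tsum_congr fun ω' => ?_
  have hmem : ω v = ω' v ↔ ω' ∈ cylinder {v} ω := by simp [cylinder, eq_comm]
  rw [PMF.filter_apply, ← Set.indicator_indicator]
  by_cases hv : ω v = ω' v
  · rw [if_pos hv, Set.indicator_of_mem (hmem.1 hv)]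
  · rw [if_neg hv, Set.indicator_of_notMem (fun h => hv (hmem.2 h)), zero_mul]

/-- Read `pab = P(abxyl)`, `pa = P(axyl)`, `pb = P(bxyl)`, `pxy = P(xyl)`, `pax = P(axl)`, `pby =
P(byl)`, `px = P(xl)`, `py = P(yl)`, `q = P(l)`, `r = P(xy)`. Then `e1` to `e4` are the four
independences. -/
lemma div_div_eq_div_mul_div {pab pa pb pxy pax pby px py q r : ℝ≥0∞} (hab : pab ≠ ∞) (ha : pa ≠ ∞)
    (hb : pb ≠ ∞) (hxy : pxy ≠ ∞) (hax : pax ≠ ∞) (hby : pby ≠ ∞) (hx : px ≠ ∞) (hy : py ≠ ∞)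
    (hq : q ≠ ∞) (hr : r ≠ ∞) (hx0 : px ≠ 0) (hy0 : py ≠ 0) (hq0 : q ≠ 0) (hr0 : r ≠ 0)
    (e1 : pa * px = pax * pxy) (e2 : pb * py = pby * pxy) (e3 : pab * pxy = pa * pb)
    (e4 : pxy = q * r) : pab / q / r = pax / px * (pby / py) := by
  lift pab to NNReal using hab
  lift pa to NNReal using ha
  lift pb to NNReal using hb
  lift pxy to NNReal using hxy
  lift pax to NNReal using hax
  lift pby to NNReal using hby
  lift px to NNReal using hx
  lift py to NNReal using hy
  lift q to NNReal using hq
  lift r to NNReal using hr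
  have hx0 : px ≠ 0 := by exact_mod_cast hx0
  have hy0 : py ≠ 0 := by exact_mod_cast hy0
  have hq0 : q ≠ 0 := by exact_mod_cast hq0
  have hr0 : r ≠ 0 := by exact_mod_cast hr0
  norm_cast at e1 e2 e3 e4
  rw [← ENNReal.coe_div hq0, ← ENNReal.coe_div hr0, ← ENNReal.coe_div hx0, ← ENNReal.coe_div hy0,
    ← ENNReal.coe_mul, ENNReal.coe_inj, div_div, ← e4, div_mul_div_comm,
    div_eq_div_iff (e4 ▸ mul_ne_zero hq0 hr0) (mul_ne_zero hx0 hy0)]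
  have hxy0 : pxy ≠ 0 := e4 ▸ mul_ne_zero hq0 hr0
  refine mul_right_cancel₀ hxy0 ?_
  calc pab * (px * py) * pxy = pab * pxy * (px * py) := by ring
    _ = (pa * px) * (pb * py) := by rw [e3]; ring
    _ = pax * pby * pxy * pxy := by rw [e1, e2]; ring

/-- If the variables in `L` are independent of the settings `x`, `y` and screen off the outcome `a`
(with setting `x`) from the outcome `b` (with setting `y`), then they are hidden variables of a
factorisable model. -/
theorem condProb_eq_tsum_condDist {L : Set V} {a b x y : V} (hx : x ∉ L) (hy : y ∉ L)
    (hind : CondIndep p L {x, y} ∅) (ha : CondIndep p {a} {y} ({x} ∪ L))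
    (hb : CondIndep p {b} {x} ({y} ∪ L)) (hab : CondIndep p {a} {b} ({x, y} ∪ L))
    {ω : ∀ v, Val v} (hω : marg p {x, y} ω ≠ 0) :
    condProb p {a, b} {x, y} ω =
      ∑' l, p l * condDist p (cylinder {x} ω ∩ cylinder L l) a (ω a) *
        condDist p (cylinder {y} ω ∩ cylinder L l) b (ω b) := by
  rw [condProb, ← tsum_mul_div_marg _ L, div_eq_mul_inv, ← ENNReal.tsum_mul_right]
  refine tsum_congr fun l => ?_
  by_cases hl : p l = 0
  · simp [hl]
  have hdx : Disjoint {x} L := Set.disjoint_singleton_left.2 hx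
  have hdy : Disjoint {y} L := Set.disjoint_singleton_left.2 hy
  have hdxy : Disjoint {x, y} L := Set.disjoint_left.2 fun v hv => by
    rcases hv with rfl | rfl <;> assumption
  have e1 := ha.toOuterMeasure_mul hdx ω l
  have e2 := hb.toOuterMeasure_mul hdy ω l
  have e3 := hab.toOuterMeasure_mul hdxy ω l
  have hmL := marg_ne_zero hl L
  have e4 : p.toOuterMeasure (cylinder {x, y} ω ∩ cylinder L l) =
      marg p L l * marg p {x, y} ω := by
    -- Since `L` avoids the settings, a single assignment can carry `l` on `L` and `ω` on `x`, `y`.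
    have h := hind (override L (fun v => l v) ω)
    simp only [Set.union_empty, marg_empty, mul_one] at h
    rw [cylinder_inter_cylinder fun v hv hvL => (Set.disjoint_left.1 hdxy hv hvL).elim,
      toOuterMeasure_cylinder, Set.union_comm, h]
    congr 1
    · exact dependsOn_marg p L fun v hv => override_of_mem _ _ hv
    · exact dependsOn_marg p _ fun v hv => override_of_notMem _ _ (Set.disjoint_left.1 hdxy hv)
  have hxy0 : p.toOuterMeasure (cylinder {x, y} ω ∩ cylinder L l) ≠ 0 := by
    rw [e4]
    exact mul_ne_zero hmL hω
  have hx0 : p.toOuterMeasure (cylinder {x} ω ∩ cylinder L l) ≠ 0 := fun h0 => hxy0 <|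
    le_antisymm (h0 ▸ p.toOuterMeasure.mono (Set.inter_subset_inter_left _
      fun _ h v hv => h v (.inl hv))) zero_le
  have hy0 : p.toOuterMeasure (cylinder {y} ω ∩ cylinder L l) ≠ 0 := fun h0 => hxy0 <|
    le_antisymm (h0 ▸ p.toOuterMeasure.mono (Set.inter_subset_inter_left _
      fun _ h v hv => h v (.inr hv))) zero_le
  rw [condDist_apply hx0, condDist_apply hy0, ← Set.inter_assoc, ← Set.inter_assoc,
    ← cylinder_union, ← cylinder_union]
  have hyx : ({y} ∪ {x} : Set V) = {x, y} := Set.union_comm _ _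
  have hxy : ({x} ∪ {y} : Set V) = {x, y} := rfl
  have hab' : ({a, b} : Set V) = {a} ∪ {b} := rfl
  rw [Set.union_assoc, hyx] at e1
  rw [Set.union_assoc, hxy] at e2
  rw [hab']
  rw [mul_assoc, mul_assoc, ← div_eq_mul_inv]
  congr 1
  exact div_div_eq_div_mul_div (toOuterMeasure_ne_top _) (toOuterMeasure_ne_top _)
    (toOuterMeasure_ne_top _) (toOuterMeasure_ne_top _) (toOuterMeasure_ne_top _)
    (toOuterMeasure_ne_top _) (toOuterMeasure_ne_top _) (toOuterMeasure_ne_top _)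
    (marg_ne_top _ _ _) (marg_ne_top _ _ _) hx0 hy0 hmL hω e1 e2 e3 e4

end HiddenVariable

/-! ### Faithful models are noncontextual -/

section Main

variable {M O : Type u} {S : BinaryScenario M} {P : Phenomenon S O}

lemma CausalModel.marg_dist (Γ : CausalModel P) (T : Set Obs)
    (ω : ∀ v, NodeVal M O Γ.LatentVal v) :
    marg P.dist T (fun o => ω (.inl o)) = marg Γ.joint (Sum.inl '' T) ω := by
  classical
  rw [← Γ.reproduces, marg, PMF.map_comp, PMF.map_apply, marg_eq_toOuterMeasure,
    PMF.toOuterMeasure_apply]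
  refine tsum_congr fun ω' => ?_
  rw [Set.indicator_apply]
  congr 1
  simp only [funext_iff, Function.comp_apply, Subtype.forall, Set.forall_mem_image,
    Set.mem_ofPred_eq, eq_comm]

lemma CausalModel.condProb_dist (Γ : CausalModel P) (T U : Set Obs)
    (ω : ∀ v, NodeVal M O Γ.LatentVal v) :
    condProb P.dist T U (fun o => ω (.inl o)) =
      condProb Γ.joint (Sum.inl '' T) (Sum.inl '' U) ω := by
  rw [condProb, Γ.marg_dist, Γ.marg_dist, Set.image_union, condProb]

/-- Cross-multiplication where `marg p T ω ≠ 0`; elsewhere both sides vanish. Keeping `T` as a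
variable allows either order of the two settings. -/
lemma condIndep_of_condProb_eq {V : Type*} {Val : V → Type*} {p : PMF (∀ v, Val v)} {a x y : V}
    {T : Set V} (hT : T = {x} ∪ {y})
    (h : ∀ ω, marg p T ω ≠ 0 → condProb p {a} T ω = condProb p {a} {x} ω) :
    CondIndep p {y} {a} {x} := by
  intro ω
  have hset : ({y} ∪ {a} ∪ {x} : Set V) = {a} ∪ T := by
    ext v
    simp only [hT, Set.mem_union]
    tauto
  rw [hset, show ({y} ∪ {x} : Set V) = T by rw [hT, Set.union_comm]]
  by_cases h0 : marg p T ω = 0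
  · have : marg p ({a} ∪ T) ω = 0 :=
      le_antisymm ((marg_anti p Set.subset_union_right ω).trans h0.le) zero_le
    rw [h0, this, zero_mul, zero_mul]
  · have hx0 : marg p {x} ω ≠ 0 := fun hx => h0 <|
      le_antisymm ((marg_anti p (hT ▸ Set.subset_union_left) ω).trans hx.le) zero_le
    have h := h ω h0
    rw [condProb, condProb, ENNReal.div_eq_div_iff hx0 (marg_ne_top _ _ _) h0 (marg_ne_top _ _ _)]
      at h
    rw [mul_comm, h]

/-- A phenomenon without disturbance that has a faithful causal model is KS-noncontextual. -/
theorem CausalModel.Faithful.ksNoncontextual {Γ : CausalModel P} (hΓ : Γ.Faithful)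
    (hND : P.NoDisturbance) : P.KSNoncontextual := by
  let _ := Γ.fintypeLatent
  have hA : CondIndep P.dist {.Y} {.A} {.X} := by
    refine condIndep_of_condProb_eq (T := {.X, .Y}) (Set.insert_eq _ _) ?_
    exact fun ω h => (hND ω h).1
  have hB : CondIndep P.dist {.X} {.B} {.Y} := by
    refine condIndep_of_condProb_eq (T := {.X, .Y}) (Set.pair_comm _ _) ?_
    exact fun ω h => (hND ω h).2
  have hdA := hΓ _ _ _ (by simp) (by simp) (by simp) hA
  have hdB := hΓ _ _ _ (by simp) (by simp) (by simp) hB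
  simp only [Set.image_singleton] at hdA hdB
  obtain ⟨L, hx, hy, hind, ha, hb, hab⟩ :=
    Γ.compatible.exists_screening_set (by simp) (by simp) (by simp) hdA hdB
  -- Only the latent values of `ω₀` matter: they extend an observable assignment to all nodes.
  obtain ⟨ω₀, -⟩ := Γ.joint.support_nonempty
  -- The hidden variable is a whole assignment, drawn from the joint distribution independently of
  -- the actual run; the responses read only its coordinates in `L`.
  refine ⟨∀ v, NodeVal M O Γ.LatentVal v, Γ.joint,
    fun x l => condDist Γ.joint ({ω | ω (.inl .X) = x} ∩ cylinder L l) (.inl .A),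
    fun y l => condDist Γ.joint ({ω | ω (.inl .Y) = y} ∩ cylinder L l) (.inl .B), ?_⟩
  intro ω hω
  obtain ⟨ω', rfl⟩ : ∃ ω' : ∀ v, NodeVal M O Γ.LatentVal v, ω = fun o => ω' (.inl o) :=
    ⟨Sum.rec ω fun l => ω₀ (.inr l), rfl⟩
  have hcyl : ∀ o : Obs, cylinder {.inl o} ω' =
      {η : ∀ v, NodeVal M O Γ.LatentVal v | η (.inl o) = ω' (.inl o)} := fun o => by
    ext η
    simp [cylinder]
  have hω' : marg Γ.joint {.inl .X, .inl .Y} ω' ≠ 0 := by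
    rwa [← Set.image_pair, ← Γ.marg_dist]
  have key := condProb_eq_tsum_condDist hx hy hind ha hb hab hω'
  rw [← Set.image_pair, ← Set.image_pair, ← Γ.condProb_dist, hcyl, hcyl] at key
  exact key

end Main

end KSFineTuning

end

theorem corollary2 {M O : Type u} [Fintype M] [Fintype O]
    (S : KSFineTuning.BinaryScenario M) (P : KSFineTuning.Phenomenon S O)
    (hND : P.NoDisturbance)
    (s : O → O → M → M → ℝ) (β : ℝ)
    (hKS : KSFineTuning.IsKSInequality S s β) (hviol : P.Violates s β)
    (Γ : KSFineTuning.CausalModel P) :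
    Γ.FineTuned := fun hΓ =>
  hviol.2.not_ge (hKS.2 P (hΓ.ksNoncontextual hND) hviol.1)
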